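/- All vector spaces are over $\mathbb{C}$, locally convex spaces are Hausdorff, and $\widehat\otimes$ denotes the complete projective tensor product of complete locally convex spaces. A $\widehat\otimes$-algebra is a unital associative algebra on a complete locally convex space with jointly continuous multiplication; homomorphisms of $\widehat\otimes$-algebras are continuous and unital. $\widehat\otimes$-(bi)modules are complete locally convex unital (bi)modules with jointly continuous actions. A Hopf $\widehat\otimes$-algebra is a Hopf algebra in the symmetric monoidal category of complete locally convex spaces with $\widehat\otimes$; its comultiplication, counit and antipode are $\Delta$, $\varepsilon$, $S$, and we write $\Delta(h)=\sum h_{(1)}\otimes h_{(2)}$ in generalized Sweedler notation (a limit of finite sums of elementary tensors). For a Hopf $\widehat\otimes$-algebra $H$, an $H$-$\widehat\otimes$-module algebra is a $\widehat\otimes$-algebra $A$ that is a left $H$-$\widehat\otimes$-module with $h\cdot(ab)=\sum (h_{(1)}\cdot a)(h_{(2)}\cdot b)$ and $h\cdot 1=\varepsilon(h)1$. A $\widehat\otimes$-algebra homomorphism $\psi\colon H\to B$ defines the adjoint action $h\cdot b=\sum\psi(h_{(1)})\,b\,\psi(S(h_{(2)}))$ of $H$ on $B$. The analytic smash product $A\mathbin{\widehat\#}H$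 is a $\widehat\otimes$-algebra with $\widehat\otimes$-algebra homomorphisms $i_A\colon A\to A\mathbin{\widehat\#}H$ and $j_H\colon H\to A\mathbin{\widehat\#}H$ such that $i_A$ is an $H$-module morphism for the adjoint action along $j_H$, and such that for every $\widehat\otimes$-algebra $B$, every $\widehat\otimes$-algebra homomorphism $\psi\colon H\to B$ and every $\widehat\otimes$-algebra homomorphism $\varphi\colon A\to B$ that is an $H$-module morphism for the adjoint action along $\psi$, there is a unique $\widehat\otimes$-algebra homomorphism $\theta\colon A\mathbin{\widehat\#}H\to B$ with $\theta i_A=\varphi$ and $\theta j_H=\psi$. A $\widehat\otimes$-algebra homomorphism $\varphi\colon A\to B$ satisfies Property (UDE) if for every $B$-$\widehat\otimes$-bimodule $X$ the map $D\mapsto D\varphi$ from the continuous derivations $B\to X$ to the continuous derivations $A\to X$ is bijective. **Theorem.** Let $\beta\colon H\to K$ be a homomorphism of Hopf $\widehat\otimes$-algebras, let $R$ be an $H$-$\widehat\otimes$-module algebra and $S$ a $K$-$\widehat\otimes$-module algebra, and let $\alpha\colon R\to S$ be a $\widehat\otimes$-algebra homomorphism such that $\alpha(h\cdot r)=\beta(h)\cdot\alpha(r)$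 for all $h\in H$, $r\in R$. Suppose that $\alpha$ and $\beta$ both have dense range and both satisfy Property (UDE). Then the unique $\widehat\otimes$-algebra homomorphism $\alpha\mathbin{\widehat\#}\beta\colon R\mathbin{\widehat\#}H\to S\mathbin{\widehat\#}K$ with $i_R(r)j_H(h)\mapsto i_S(\alpha(r))\,j_K(\beta(h))$ for all $r\in R$, $h\in H$ (that is, $r\otimes h\mapsto\alpha(r)\otimes\beta(h)$) exists, has dense range and satisfies Property (UDE). -/

import Mathlib

open scoped TensorProduct Topology
open UniformSpace

universe u

set_option linter.unusedSectionVars false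

noncomputable section

namespace HatTensor

/-! ### Complete locally convex spaces and algebras -/

/-- Complete Hausdorff locally convex spaces over `ℂ` (the topology is given by a family of
seminorms; the uniformity is the one that belongs to the topological vector space). -/
class IsCompleteLCS (E : Type*) [AddCommGroup E] [Module ℂ E] [UniformSpace E] : Prop extends
    IsUniformAddGroup E, ContinuousSMul ℂ E, PolynormableSpace ℂ E, CompleteSpace E, T2Space E

/-- `⊗̂`-algebras: unital associative algebras on a complete Hausdorff locally convex space whose
multiplication is jointly continuous. -/
class IsHatAlgebra (A : Type*) [Ring A] [Algebra ℂ A] [UniformSpace A] : Prop extends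
    IsCompleteLCS A, ContinuousMul A

instance {A : Type*} [Ring A] [Algebra ℂ A] [UniformSpace A] [IsHatAlgebra A] :
    IsTopologicalRing A where

instance : IsHatAlgebra ℂ where
  toPolynormableSpace := (norm_withSeminorms ℂ ℂ).toPolynormableSpace

section Bilinear

variable {E F G : Type*} [AddCommGroup E] [Module ℂ E] [AddCommGroup F] [Module ℂ F]
  [AddCommGroup G] [Module ℂ G]

/-- A bilinear map into a locally convex space is jointly continuous as soon as its compositions
with the seminorms of a defining family are. -/
theorem continuous_bilin_of_seminorm [TopologicalSpace E] [IsTopologicalAddGroup E]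
    [TopologicalSpace F] [IsTopologicalAddGroup F] [TopologicalSpace G] {ι : Type*}
    {p : SeminormFamily ℂ G ι} (hp : WithSeminorms p) (b : E →ₗ[ℂ] F →ₗ[ℂ] G)
    (h : ∀ i, Continuous fun z : E × F => p i (b z.1 z.2)) :
    Continuous fun z : E × F => b z.1 z.2 := by
  rw [continuous_iff_continuousAt]
  rintro ⟨x, y⟩
  refine (hp.tendsto_nhds _ _).2 fun i ε hε => ?_
  have h1 : Continuous fun z : E × F =>
      p i (b (z.1 - x) (z.2 - y)) + p i (b (z.1 - x) y) + p i (b x (z.2 - y)) := by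
    have a1 : Continuous fun z : E × F => p i (b (z.1 - x) (z.2 - y)) :=
      (h i).comp (by fun_prop : Continuous fun z : E × F => (z.1 - x, z.2 - y))
    have a2 : Continuous fun z : E × F => p i (b (z.1 - x) y) :=
      (h i).comp (by fun_prop : Continuous fun z : E × F => (z.1 - x, y))
    have a3 : Continuous fun z : E × F => p i (b x (z.2 - y)) :=
      (h i).comp (by fun_prop : Continuous fun z : E × F => (x, z.2 - y))
    exact (a1.add a2).add a3
  have h2 := h1.tendsto (x, y)
  simp only [sub_self, map_zero, LinearMap.zero_apply, add_zero] at h2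
  filter_upwards [h2.eventually (gt_mem_nhds hε)] with z hz
  refine lt_of_le_of_lt ?_ hz
  have : b z.1 z.2 - b x y = b (z.1 - x) (z.2 - y) + b (z.1 - x) y + b x (z.2 - y) := by
    simp only [map_sub, LinearMap.sub_apply]; abel
  rw [this]
  exact (map_add_le_add _ _ _).trans (by gcongr; exact map_add_le_add _ _ _)

theorem continuous_of_seminorm_bound [TopologicalSpace E] [IsTopologicalAddGroup E]
    [TopologicalSpace F] [IsTopologicalAddGroup F] (p : Seminorm ℂ G) (b : E →ₗ[ℂ] F →ₗ[ℂ] G)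
    {q : Seminorm ℂ E} {r : Seminorm ℂ F} (hq : Continuous q) (hr : Continuous r)
    (h : ∀ x y, p (b x y) ≤ q x * r y) : Continuous fun z : E × F => p (b z.1 z.2) := by
  rw [continuous_iff_continuousAt]
  rintro ⟨x, y⟩
  have hqr : Continuous fun z : E × F =>
      q (z.1 - x) * r (z.2 - y) + q (z.1 - x) * r y + q x * r (z.2 - y) := by fun_prop
  have h1 := hqr.tendsto (x, y)
  simp only [sub_self, map_zero, zero_mul, mul_zero, add_zero] at h1
  refine tendsto_iff_dist_tendsto_zero.2 (squeeze_zero (fun _ => dist_nonneg) (fun z => ?_) h1)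
  rw [Real.dist_eq]
  refine (abs_sub_map_le_sub p _ _).trans ?_
  have : b z.1 z.2 - b x y = b (z.1 - x) (z.2 - y) + b (z.1 - x) y + b x (z.2 - y) := by
    simp only [map_sub, LinearMap.sub_apply]; abel
  rw [this]
  exact (map_add_le_add _ _ _).trans (add_le_add ((map_add_le_add _ _ _).trans
    (add_le_add (h _ _) (h _ _))) (h _ _))

theorem exists_seminorm_of_mem_nhds {X : Type*} [AddCommGroup X] [Module ℂ X] [TopologicalSpace X]
    [PolynormableSpace ℂ X] {U : Set X} (hU : U ∈ 𝓝 (0 : X)) :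
    ∃ q : Seminorm ℂ X, Continuous q ∧ ∀ x, q x < 1 → x ∈ U := by
  have hw := PolynormableSpace.withSeminorms ℂ X
  have : IsTopologicalAddGroup X := hw.topologicalAddGroup
  have : ContinuousSMul ℂ X := hw.continuousSMul
  obtain ⟨⟨s, ε⟩, hε, hs⟩ := hw.hasBasis_zero_ball.mem_iff.1 hU
  simp only at hε hs
  set q₀ : Seminorm ℂ X := s.sup (fun p : {p : Seminorm ℂ X // Continuous p} => p.1) with hq₀
  have hc : Continuous q₀ :=
    Seminorm.continuous (r := 1)
      (SeminormFamily.basisSets_mem_nhds _ (fun i => i.2) _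
        (SeminormFamily.basisSets_mem _ s one_pos))
  refine ⟨Real.toNNReal ε⁻¹ • q₀, ?_, fun x hx => hs ?_⟩
  · exact (continuous_const.mul hc : Continuous fun x => (Real.toNNReal ε⁻¹ : ℝ) * q₀ x)
  · rw [Seminorm.mem_ball_zero]
    have hx' : (Real.toNNReal ε⁻¹ : ℝ) * q₀ x < 1 := hx
    rwa [Real.coe_toNNReal _ (inv_pos.2 hε).le, inv_mul_lt_iff₀ hε, mul_one] at hx'

/-- A jointly continuous bilinear form of seminorm type is bounded by a product of continuous
seminorms. -/
theorem exists_seminorm_bound [TopologicalSpace E] [IsTopologicalAddGroup E]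
    [TopologicalSpace F] [IsTopologicalAddGroup F] [PolynormableSpace ℂ E] [PolynormableSpace ℂ F]
    (p : Seminorm ℂ G) (b : E →ₗ[ℂ] F →ₗ[ℂ] G)
    (h : Continuous fun z : E × F => p (b z.1 z.2)) :
    ∃ (q : Seminorm ℂ E) (r : Seminorm ℂ F), Continuous q ∧ Continuous r ∧
      ∀ x y, p (b x y) ≤ q x * r y := by
  have h0 : {z : E × F | p (b z.1 z.2) < 1} ∈ 𝓝 ((0 : E), (0 : F)) := by
    have := h.tendsto (0, 0)
    simp only [map_zero] at this
    exact this.eventually (gt_mem_nhds one_pos)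
  rw [nhds_prod_eq, Filter.mem_prod_iff] at h0
  obtain ⟨U, hU, V, hV, hUV⟩ := h0
  obtain ⟨q, hq, hqU⟩ := exists_seminorm_of_mem_nhds hU
  obtain ⟨r, hr, hrV⟩ := exists_seminorm_of_mem_nhds hV
  refine ⟨q, r, hq, hr, fun x y => ?_⟩
  have hb : ∀ s t : ℝ, 0 < s → 0 < t → q x < s → r y < t → p (b x y) ≤ s * t := by
    intro s t hs ht hxs hyt
    have h1 : ((s : ℂ)⁻¹ • x, (t : ℂ)⁻¹ • y) ∈ U ×ˢ V := by
      refine ⟨hqU _ ?_, hrV _ ?_⟩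
      · rw [map_smul_eq_mul, norm_inv, Complex.norm_of_nonneg hs.le, inv_mul_lt_iff₀ hs, mul_one]
        exact hxs
      · rw [map_smul_eq_mul, norm_inv, Complex.norm_of_nonneg ht.le, inv_mul_lt_iff₀ ht, mul_one]
        exact hyt
    have h2 : p (b ((s : ℂ)⁻¹ • x) ((t : ℂ)⁻¹ • y)) < 1 := hUV h1
    rw [LinearMap.map_smul, LinearMap.map_smul, LinearMap.smul_apply, map_smul_eq_mul,
      map_smul_eq_mul, norm_inv,
      norm_inv, Complex.norm_of_nonneg hs.le, Complex.norm_of_nonneg ht.le,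
      inv_mul_lt_iff₀ ht, inv_mul_lt_iff₀ hs] at h2
    nlinarith
  refine le_of_forall_pos_le_add fun ε hε => ?_
  have hlim : Filter.Tendsto (fun δ : ℝ => (q x + δ) * (r y + δ)) (𝓝[>] 0) (𝓝 (q x * r y)) := by
    have : Continuous fun δ : ℝ => (q x + δ) * (r y + δ) := by fun_prop
    simpa using (this.tendsto 0).mono_left nhdsWithin_le_nhds
  have h3 : ∀ᶠ δ in 𝓝[>] (0 : ℝ), (q x + δ) * (r y + δ) < q x * r y + ε :=
    hlim.eventually (gt_mem_nhds (by linarith))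
  obtain ⟨δ, hδ, hδ0⟩ := (h3.and self_mem_nhdsWithin).exists
  have hδ0' : 0 < δ := hδ0
  have := hb (q x + δ) (r y + δ) (by positivity) (by positivity) (by linarith) (by linarith)
  linarith

end Bilinear

/-! ### The projective topology on the algebraic tensor product -/

/-- The algebraic tensor product, to be endowed with the projective topology. -/
def ProjTensor (E F : Type*) [AddCommGroup E] [Module ℂ E] [AddCommGroup F] [Module ℂ F] :=
  E ⊗[ℂ] F

section ProjTensor

variable (E F : Type*) [AddCommGroup E] [Module ℂ E] [AddCommGroup F] [Module ℂ F]

instance : AddCommGroup (ProjTensor E F) := inferInstanceAs (AddCommGroup (E ⊗[ℂ] F))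
instance : Module ℂ (ProjTensor E F) := inferInstanceAs (Module ℂ (E ⊗[ℂ] F))

/-- The canonical bilinear map `(x, y) ↦ x ⊗ y`. -/
def ProjTensor.mk : E →ₗ[ℂ] F →ₗ[ℂ] ProjTensor E F := TensorProduct.mk ℂ E F

variable {E F} in
@[elab_as_elim]
theorem ProjTensor.induction {P : ProjTensor E F → Prop} (t : ProjTensor E F) (h0 : P 0)
    (ht : ∀ x y, P (ProjTensor.mk E F x y)) (ha : ∀ s t, P s → P t → P (s + t)) : P t :=
  TensorProduct.induction_on (motive := P) t h0 ht ha

variable [TopologicalSpace E] [TopologicalSpace F]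

/-- The seminorms `p` on `E ⊗ F` for which the canonical bilinear map `E × F → (E ⊗ F, p)` is
jointly continuous. -/
def projFamily : SeminormFamily ℂ (ProjTensor E F)
    {p : Seminorm ℂ (ProjTensor E F) // Continuous fun z : E × F => p (ProjTensor.mk E F z.1 z.2)} :=
  fun p => p.1

/-- The projective topology: the finest locally convex topology on `E ⊗ F` for which the canonical
bilinear map `E × F → E ⊗ F` is jointly continuous. -/
instance : TopologicalSpace (ProjTensor E F) := (projFamily E F).moduleFilterBasis.topology

theorem projFamily_withSeminorms : WithSeminorms (projFamily E F) := ⟨rfl⟩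

instance : IsTopologicalAddGroup (ProjTensor E F) :=
  (projFamily_withSeminorms E F).topologicalAddGroup

instance : ContinuousSMul ℂ (ProjTensor E F) := (projFamily_withSeminorms E F).continuousSMul

instance : PolynormableSpace ℂ (ProjTensor E F) :=
  (projFamily_withSeminorms E F).toPolynormableSpace

instance : UniformSpace (ProjTensor E F) := IsTopologicalAddGroup.rightUniformSpace _

instance : IsUniformAddGroup (ProjTensor E F) := isUniformAddGroup_of_addCommGroup

instance : UniformContinuousConstSMul ℂ (ProjTensor E F) :=
  uniformContinuousConstSMul_of_continuousConstSMul ℂ (ProjTensor E F)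

theorem ProjTensor.continuous_mk [IsTopologicalAddGroup E] [IsTopologicalAddGroup F] :
    Continuous fun z : E × F => ProjTensor.mk E F z.1 z.2 :=
  continuous_bilin_of_seminorm (projFamily_withSeminorms E F) _ fun i => i.2

end ProjTensor

section ProjSeminorm

variable {E F : Type*} [AddCommGroup E] [Module ℂ E] [AddCommGroup F] [Module ℂ F]

/-- The projective tensor product of two seminorms: the largest seminorm `s` on `E ⊗ F` with
`s (x ⊗ y) ≤ q x * r y`. -/
def projSeminorm (q : Seminorm ℂ E) (r : Seminorm ℂ F) : Seminorm ℂ (ProjTensor E F) :=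
  sSup {s | ∀ x y, s (ProjTensor.mk E F x y) ≤ q x * r y}

theorem projSeminorm_bddAbove (q : Seminorm ℂ E) (r : Seminorm ℂ F) :
    BddAbove {s : Seminorm ℂ (ProjTensor E F) | ∀ x y, s (ProjTensor.mk E F x y) ≤ q x * r y} := by
  rw [Seminorm.bddAbove_iff]
  have h : ∀ t : ProjTensor E F, ∃ C : ℝ, ∀ s : Seminorm ℂ (ProjTensor E F),
      (∀ x y, s (ProjTensor.mk E F x y) ≤ q x * r y) → s t ≤ C := by
    intro t
    induction t using ProjTensor.induction with
    | h0 => exact ⟨0, fun s _ => by simp⟩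
    | ht x y => exact ⟨q x * r y, fun s hs => hs x y⟩
    | ha t u ht hu =>
      obtain ⟨C, hC⟩ := ht
      obtain ⟨D, hD⟩ := hu
      exact ⟨C + D, fun s hs => (map_add_le_add s t u).trans (add_le_add (hC s hs) (hD s hs))⟩
  choose C hC using h
  refine ⟨C, ?_⟩
  rintro _ ⟨s, hs, rfl⟩ t
  exact hC t s hs

theorem projSeminorm_mk_le (q : Seminorm ℂ E) (r : Seminorm ℂ F) (x : E) (y : F) :
    projSeminorm q r (ProjTensor.mk E F x y) ≤ q x * r y := by
  rw [projSeminorm, Seminorm.sSup_apply (projSeminorm_bddAbove q r)]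
  refine Real.iSup_le (fun s => s.2 x y) (by positivity)

theorem le_mul_projSeminorm {q : Seminorm ℂ E} {r : Seminorm ℂ F}
    (s : Seminorm ℂ (ProjTensor E F)) {C : ℝ} (hC : 0 ≤ C)
    (h : ∀ x y, s (ProjTensor.mk E F x y) ≤ C * (q x * r y)) (t : ProjTensor E F) :
    s t ≤ C * projSeminorm q r t := by
  rcases hC.eq_or_lt with rfl | hC
  · have : s t ≤ 0 := by
      induction t using ProjTensor.induction with
      | h0 => simp
      | ht x y => simpa using h x y
      | ha t u ht hu => exact (map_add_le_add s t u).trans (by linarith)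
    simpa using this
  · have h1 : Real.toNNReal C⁻¹ • s ≤ projSeminorm q r := by
      refine le_csSup (projSeminorm_bddAbove q r) fun x y => ?_
      change (Real.toNNReal C⁻¹ : ℝ) * s _ ≤ _
      rw [Real.coe_toNNReal _ (inv_pos.2 hC).le, inv_mul_le_iff₀ hC]
      exact h x y
    have h2 : (Real.toNNReal C⁻¹ : ℝ) * s t ≤ projSeminorm q r t := h1 t
    rwa [Real.coe_toNNReal _ (inv_pos.2 hC).le, inv_mul_le_iff₀ hC] at h2

variable [TopologicalSpace E] [IsTopologicalAddGroup E]
  [TopologicalSpace F] [IsTopologicalAddGroup F]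

theorem continuous_projSeminorm {q : Seminorm ℂ E} {r : Seminorm ℂ F} (hq : Continuous q)
    (hr : Continuous r) : Continuous (projSeminorm q r) := by
  have hc : Continuous fun z : E × F => projSeminorm q r (ProjTensor.mk E F z.1 z.2) :=
    continuous_of_seminorm_bound _ (ProjTensor.mk E F) hq hr (projSeminorm_mk_le q r)
  exact (projFamily_withSeminorms E F).continuous_seminorm ⟨projSeminorm q r, hc⟩

/-- Multiplication of the algebraic tensor product of two algebras, and its joint continuity. -/
instance {A B : Type*} [Ring A] [Algebra ℂ A] [Ring B] [Algebra ℂ B] : Ring (ProjTensor A B) :=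
  inferInstanceAs (Ring (A ⊗[ℂ] B))

instance {A B : Type*} [Ring A] [Algebra ℂ A] [Ring B] [Algebra ℂ B] :
    Algebra ℂ (ProjTensor A B) :=
  inferInstanceAs (Algebra ℂ (A ⊗[ℂ] B))

theorem ProjTensor.mk_mul_mk {A B : Type*} [Ring A] [Algebra ℂ A] [Ring B] [Algebra ℂ B]
    (a a' : A) (b b' : B) : ProjTensor.mk A B a b * ProjTensor.mk A B a' b' =
      ProjTensor.mk A B (a * a') (b * b') :=
  Algebra.TensorProduct.tmul_mul_tmul a a' b b'

theorem ProjTensor.one_eq_mk {A B : Type*} [Ring A] [Algebra ℂ A] [Ring B] [Algebra ℂ B] :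
    (1 : ProjTensor A B) = ProjTensor.mk A B 1 1 := rfl

instance {A B : Type*} [Ring A] [Algebra ℂ A] [UniformSpace A] [IsHatAlgebra A] [Ring B]
    [Algebra ℂ B] [UniformSpace B] [IsHatAlgebra B] : IsTopologicalRing (ProjTensor A B) where
  continuous_mul := by
    refine continuous_bilin_of_seminorm (PolynormableSpace.withSeminorms ℂ (ProjTensor A B))
      (LinearMap.mul ℂ (ProjTensor A B)) fun p => ?_
    obtain ⟨q, r, hq, hr, hqr⟩ := exists_seminorm_bound p.1 (ProjTensor.mk A B)
      (p.2.comp (ProjTensor.continuous_mk A B))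
    obtain ⟨q₁, q₂, hq₁, hq₂, hq12⟩ := exists_seminorm_bound q (LinearMap.mul ℂ A)
      (hq.comp continuous_mul)
    obtain ⟨r₁, r₂, hr₁, hr₂, hr12⟩ := exists_seminorm_bound r (LinearMap.mul ℂ B)
      (hr.comp continuous_mul)
    refine continuous_of_seminorm_bound p.1 _ (continuous_projSeminorm hq₁ hr₁)
      (continuous_projSeminorm hq₂ hr₂) fun t u => ?_
    rw [mul_comm]
    refine le_mul_projSeminorm (p.1.comp (LinearMap.mulRight ℂ u)) (apply_nonneg _ _)
      (fun a b => ?_) t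
    rw [mul_comm]
    refine le_mul_projSeminorm (p.1.comp (LinearMap.mulLeft ℂ (ProjTensor.mk A B a b)))
      (by positivity) (fun a' b' => ?_) u
    change p.1 (ProjTensor.mk A B a b * ProjTensor.mk A B a' b') ≤ _
    rw [ProjTensor.mk_mul_mk]
    have h1 : q (a * a') ≤ q₁ a * q₂ a' := hq12 a a'
    have h2 : r (b * b') ≤ r₁ b * r₂ b' := hr12 b b'
    calc p.1 (ProjTensor.mk A B (a * a') (b * b')) ≤ q (a * a') * r (b * b') := hqr _ _
      _ ≤ (q₁ a * q₂ a') * (r₁ b * r₂ b') := by gcongr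
      _ = q₁ a * r₁ b * (q₂ a' * r₂ b') := by ring

end ProjSeminorm

/-! ### Completions of locally convex spaces -/

section Completion

/-- Separately continuous extensions of jointly continuous biadditive maps to a completion are
jointly continuous. -/
theorem continuous_uncurry_of_completion {X Z T : Type*} [AddCommGroup X] [UniformSpace X]
    [IsUniformAddGroup X] [AddCommGroup Z] [TopologicalSpace Z] [IsTopologicalAddGroup Z]
    [AddCommGroup T] [UniformSpace T] [IsUniformAddGroup T] [CompleteSpace T] [T2Space T]
    (φ : X →+ Z →+ T) (hφ : Continuous fun z : X × Z => φ z.1 z.2)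
    (ψ : Completion X → Z → T) (hψ : ∀ z, Continuous fun x => ψ x z)
    (h : ∀ (x : X) z, ψ x z = φ x z) : Continuous fun z : Completion X × Z => ψ z.1 z.2 := by
  have de : IsDenseInducing (Completion.toCompl : X →+ Completion X) :=
    Completion.isDenseInducing_coe
  have df : IsDenseInducing (AddMonoidHom.id Z) :=
    ⟨Topology.IsInducing.id, denseRange_id⟩
  have key := de.extend_Z_bilin df hφ
  convert key using 1
  funext z
  obtain ⟨x, z⟩ := z
  have h2 : (fun x => ψ x z) = fun x => (de.prodMap df).extend
      (fun p : X × Z => φ p.1 p.2) (x, z) := by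
    refine Completion.denseRange_coe.equalizer (hψ z)
      (key.comp (by fun_prop : Continuous fun x : Completion X => (x, z))) ?_
    funext x
    have := (de.prodMap df).extend_eq hφ (x, z)
    exact (h x z).trans this.symm
  exact congrFun h2 x

variable (X : Type*) [AddCommGroup X] [Module ℂ X] [UniformSpace X] [IsUniformAddGroup X]
  [ContinuousSMul ℂ X] [UniformContinuousConstSMul ℂ X]

instance completion_continuousSMul : ContinuousSMul ℂ (Completion X) where
  continuous_smul := by
    let φ : X →+ ℂ →+ Completion X := AddMonoidHom.mk' (fun x : X =>
      (Completion.toCompl : X →+ Completion X).comp ((smulAddHom ℂ X).flip x))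
      (fun x y => by ext c; simp [Completion.coe_add])
    have hφ : Continuous fun z : X × ℂ => φ z.1 z.2 :=
      (Completion.continuous_coe X).comp (by fun_prop : Continuous fun z : X × ℂ => z.2 • z.1)
    have hc : ∀ c : ℂ, Continuous fun x : Completion X => c • x := fun c => continuous_const_smul c
    have hs : ∀ (x : X) (c : ℂ), c • (x : Completion X) = φ x c := fun x c =>
      (Completion.coe_smul c x).symm
    have h : Continuous fun z : Completion X × ℂ => z.2 • z.1 :=
      continuous_uncurry_of_completion (T := Completion X) φ hφ (fun x c => c • x) hc hs
    exact (h.comp continuous_swap :)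

open scoped ComplexOrder in
instance completion_polynormableSpace [PolynormableSpace ℂ X] :
    PolynormableSpace ℂ (Completion X) := by
  let _ : Module ℝ (Completion X) := Module.complexToReal _
  have hw := PolynormableSpace.withSeminorms ℂ X
  have : LocallyConvexSpace ℂ (Completion X) := by
    have hb := hw.hasBasis.hasBasis_of_isDenseInducing
      (f := ((↑) : X → Completion X)) Completion.isDenseInducing_coe
    rw [Completion.coe_zero] at hb
    refine LocallyConvexSpace.ofBasisZero ℂ (Completion X) _ _ hb fun U hU => ?_
    obtain ⟨s, r, hr, rfl⟩ := (SeminormFamily.basisSets_iff _).1 hU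
    refine Convex.closure ?_
    set q : Seminorm ℂ X := s.sup fun p : {p : Seminorm ℂ X // Continuous p} => p.1
    rintro _ ⟨x, hx, rfl⟩ _ ⟨y, hy, rfl⟩ a b ha' hb' hab'
    obtain ⟨a, ha, rfl⟩ := RCLike.nonneg_iff_exists_ofReal.1 ha'
    obtain ⟨b, hb, rfl⟩ := RCLike.nonneg_iff_exists_ofReal.1 hb'
    have hab : a + b = 1 := by simpa using congrArg Complex.re hab'
    refine ⟨(a : ℂ) • x + (b : ℂ) • y, ?_, ?_⟩
    · simp only [id, Seminorm.mem_ball_zero] at hx hy ⊢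
      refine (map_add_le_add q _ _).trans_lt ?_
      rw [map_smul_eq_mul, map_smul_eq_mul, Complex.norm_of_nonneg ha, Complex.norm_of_nonneg hb]
      rcases ha.eq_or_lt with rfl | ha
      · have : b = 1 := by linarith
        subst this; simpa using hy
      · have : b * q y ≤ b * r := by gcongr
        have : a * q x < a * r := by gcongr
        have : a * r + b * r = r := by rw [← add_mul, hab, one_mul]
        linarith
    · rw [Completion.coe_add, Completion.coe_smul, Completion.coe_smul]
      rfl
  have : IsScalarTower ℝ ℂ (Completion X) := ⟨fun a b x => mul_smul (a : ℂ) b x⟩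
  have : ContinuousSMul ℝ (Completion X) :=
    ⟨(by fun_prop : Continuous fun z : ℝ × Completion X => (z.1 : ℂ) • z.2)⟩
  exact LocallyConvexSpace.toPolynormableSpace

instance completion_isCompleteLCS [PolynormableSpace ℂ X] : IsCompleteLCS (Completion X) where

end Completion

/-! ### The complete projective tensor product -/

/-- The complete projective tensor product `E ⊗̂ F`: the completion of `E ⊗ F` with respect to the
projective topology. -/
abbrev CTensor (E F : Type*) [AddCommGroup E] [Module ℂ E] [TopologicalSpace E]
    [AddCommGroup F] [Module ℂ F] [TopologicalSpace F] := Completion (ProjTensor E F)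

/-- If `A` and `B` are `⊗̂`-algebras, then so is `A ⊗̂ B`, with
`(a ⊗ b) (a' ⊗ b') = a a' ⊗ b b'`. -/
instance {A B : Type*} [Ring A] [Algebra ℂ A] [UniformSpace A] [IsHatAlgebra A] [Ring B]
    [Algebra ℂ B] [UniformSpace B] [IsHatAlgebra B] : IsHatAlgebra (CTensor A B) where

namespace CTensor

section

variable {E F G E' F' : Type*}
  [AddCommGroup E] [Module ℂ E] [UniformSpace E] [IsCompleteLCS E]
  [AddCommGroup F] [Module ℂ F] [UniformSpace F] [IsCompleteLCS F]
  [AddCommGroup G] [Module ℂ G] [UniformSpace G] [IsCompleteLCS G]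
  [AddCommGroup E'] [Module ℂ E'] [UniformSpace E'] [IsCompleteLCS E']
  [AddCommGroup F'] [Module ℂ F'] [UniformSpace F'] [IsCompleteLCS F']

/-- The canonical bilinear map `(x, y) ↦ x ⊗ y` into the complete projective tensor product. -/
def tmul : E →ₗ[ℂ] F →ₗ[ℂ] CTensor E F :=
  (ProjTensor.mk E F).compr₂
    { toFun := fun t => (t : CTensor E F)
      map_add' := Completion.coe_add
      map_smul' := Completion.coe_smul }

theorem tmul_eq (x : E) (y : F) :
    (tmul x y : CTensor E F) = ((ProjTensor.mk E F x y : ProjTensor E F) : CTensor E F) := rfl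

theorem continuous_tmul : Continuous fun z : E × F => (tmul z.1 z.2 : CTensor E F) :=
  (Completion.continuous_coe _).comp (ProjTensor.continuous_mk E F)

/-- Two continuous linear maps on `E ⊗̂ F` that agree on elementary tensors are equal. -/
theorem ext {T : Type*} [AddCommGroup T] [Module ℂ T] [TopologicalSpace T] [T2Space T]
    {f g : CTensor E F →L[ℂ] T} (h : ∀ x y, f (tmul x y) = g (tmul x y)) : f = g := by
  refine ContinuousLinearMap.ext fun t => ?_
  refine Completion.induction_on t (isClosed_eq f.continuous g.continuous) fun t => ?_
  induction t using ProjTensor.induction with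
  | h0 => rw [Completion.coe_zero, map_zero, map_zero]
  | ht x y => exact h x y
  | ha s t hs ht => rw [Completion.coe_add, map_add, map_add, hs, ht]

/-- The linear map on the algebraic tensor product given by a bilinear map. -/
def preLift (b : E →ₗ[ℂ] F →ₗ[ℂ] G) : ProjTensor E F →ₗ[ℂ] G := TensorProduct.lift b

theorem preLift_mk (b : E →ₗ[ℂ] F →ₗ[ℂ] G) (x : E) (y : F) :
    preLift b (ProjTensor.mk E F x y) = b x y := TensorProduct.lift.tmul x y

theorem continuous_preLift (b : E →ₗ[ℂ] F →ₗ[ℂ] G) (hb : Continuous fun z : E × F => b z.1 z.2) :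
    Continuous (preLift b) := by
  have hw := PolynormableSpace.withSeminorms ℂ G
  refine hw.continuous_of_continuous_comp _ fun p => ?_
  refine (projFamily_withSeminorms E F).continuous_seminorm
    ⟨p.1.comp (preLift b), ?_⟩
  have : (fun z : E × F => (p.1.comp (preLift b)) (ProjTensor.mk E F z.1 z.2)) =
      fun z => p.1 (b z.1 z.2) := by
    funext z; rw [Seminorm.comp_apply, preLift_mk]
  rw [this]
  exact p.2.comp hb

/-- The universal property: the continuous linear map `E ⊗̂ F → G` with `x ⊗ y ↦ b x y` given by a
jointly continuous bilinear map `b`. -/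
def lift (b : E →ₗ[ℂ] F →ₗ[ℂ] G) (hb : Continuous fun z : E × F => b z.1 z.2) :
    CTensor E F →L[ℂ] G :=
  have : UniformContinuousConstSMul ℂ G := uniformContinuousConstSMul_of_continuousConstSMul ℂ G
  ContinuousLinearMap.fromCompletion ⟨preLift b, continuous_preLift b hb⟩

@[simp]
theorem lift_tmul (b : E →ₗ[ℂ] F →ₗ[ℂ] G) (hb : Continuous fun z : E × F => b z.1 z.2)
    (x : E) (y : F) : lift b hb (tmul x y) = b x y := by
  have : UniformContinuousConstSMul ℂ G := uniformContinuousConstSMul_of_continuousConstSMul ℂ G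
  rw [tmul_eq]
  exact (ContinuousLinearMap.fromCompletion_apply_coe _ _).trans (preLift_mk b x y)

/-- The map `f ⊗̂ g`. -/
def map (f : E →L[ℂ] E') (g : F →L[ℂ] F') : CTensor E F →L[ℂ] CTensor E' F' :=
  lift ((tmul : E' →ₗ[ℂ] F' →ₗ[ℂ] CTensor E' F').compl₁₂ f.toLinearMap g.toLinearMap)
    (continuous_tmul.comp (by fun_prop : Continuous fun z : E × F => (f z.1, g z.2)))

@[simp]
theorem map_tmul (f : E →L[ℂ] E') (g : F →L[ℂ] F') (x : E) (y : F) :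
    map f g (tmul x y) = tmul (f x) (g y) := lift_tmul _ _ x y

/-- The map `x ↦ x ⊗ z`. -/
def tmulRight (z : F) : E →L[ℂ] CTensor E F :=
  ⟨(tmul : E →ₗ[ℂ] F →ₗ[ℂ] CTensor E F).flip z,
    continuous_tmul.comp (by fun_prop : Continuous fun x : E => (x, z))⟩

theorem tmulRight_apply (z : F) (x : E) : tmulRight z x = tmul x z := rfl

/-- The bilinear map `(t, z) ↦ (id ⊗̂ (· ⊗ z)) t`, that is `(x ⊗ y, z) ↦ x ⊗ (y ⊗ z)`. -/
def assocBilin : CTensor E F →ₗ[ℂ] G →ₗ[ℂ] CTensor E (CTensor F G) :=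
  LinearMap.flip
    { toFun := fun z => (map (ContinuousLinearMap.id ℂ E) (tmulRight z)).toLinearMap
      map_add' := fun z w => by
        rw [← ContinuousLinearMap.toLinearMap_add]
        refine congrArg _ (ext fun x y => ?_)
        simp [tmulRight_apply]
      map_smul' := fun c z => by
        rw [RingHom.id_apply, ← ContinuousLinearMap.toLinearMap_smul]
        refine congrArg _ (ext fun x y => ?_)
        simp [tmulRight_apply] }

theorem assocBilin_tmul (x : E) (y : F) (z : G) :
    assocBilin (tmul x y) z = tmul x (tmul y z) :=
  map_tmul (ContinuousLinearMap.id ℂ E) (tmulRight z) x y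

theorem continuous_assocBilin :
    Continuous fun t : CTensor E F × G => assocBilin t.1 t.2 := by
  let κ : ProjTensor E F →ₗ[ℂ] CTensor E F :=
    { toFun := fun t => (t : CTensor E F)
      map_add' := Completion.coe_add
      map_smul' := Completion.coe_smul }
  let b : ProjTensor E F →ₗ[ℂ] G →ₗ[ℂ] CTensor E (CTensor F G) := assocBilin.comp κ
  have hb : Continuous fun t : ProjTensor E F × G => b t.1 t.2 := by
    refine continuous_bilin_of_seminorm (PolynormableSpace.withSeminorms ℂ _) b fun p => ?_
    obtain ⟨q, r, hq, hr, hqr⟩ := exists_seminorm_bound p.1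
      (tmul : E →ₗ[ℂ] CTensor F G →ₗ[ℂ] _) (p.2.comp continuous_tmul)
    obtain ⟨r₁, r₂, hr₁, hr₂, hr12⟩ := exists_seminorm_bound r
      (tmul : F →ₗ[ℂ] G →ₗ[ℂ] _) (hr.comp continuous_tmul)
    refine continuous_of_seminorm_bound p.1 b (continuous_projSeminorm hq hr₁) hr₂ fun t z => ?_
    rw [mul_comm]
    refine le_mul_projSeminorm (p.1.comp (b.flip z)) (apply_nonneg _ _) (fun x y => ?_) t
    have h1 : b.flip z (ProjTensor.mk E F x y) = tmul x (tmul y z) := assocBilin_tmul x y z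
    rw [Seminorm.comp_apply, h1]
    calc p.1 (tmul x (tmul y z)) ≤ q x * r (tmul y z) := hqr _ _
      _ ≤ q x * (r₁ y * r₂ z) := by gcongr; exact hr12 y z
      _ = r₂ z * (q x * r₁ y) := by ring
  let φ : ProjTensor E F →+ G →+ CTensor E (CTensor F G) :=
    AddMonoidHom.mk' (fun t => (b t).toAddMonoidHom) (fun s t => by ext z; simp)
  exact continuous_uncurry_of_completion φ hb (fun t z => assocBilin t z)
    (fun z => (map (ContinuousLinearMap.id ℂ E) (tmulRight z)).continuous) (fun t z => rfl)

/-- The associativity isomorphism `(x ⊗ y) ⊗ z ↦ x ⊗ (y ⊗ z)`. -/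
def assoc : CTensor (CTensor E F) G →L[ℂ] CTensor E (CTensor F G) :=
  lift assocBilin continuous_assocBilin

theorem assoc_tmul (x : E) (y : F) (z : G) :
    assoc (tmul (tmul x y) z) = tmul x (tmul y z) := by
  rw [assoc, lift_tmul, assocBilin_tmul]

/-- The canonical isomorphism `ℂ ⊗̂ E → E`. -/
def lid : CTensor ℂ E →L[ℂ] E := lift (LinearMap.lsmul ℂ E)
  (show Continuous fun z : ℂ × E => LinearMap.lsmul ℂ E z.1 z.2 from continuous_smul)

@[simp]
theorem lid_tmul (c : ℂ) (x : E) : lid (tmul c x) = c • x := lift_tmul _ _ c x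

/-- The canonical isomorphism `E ⊗̂ ℂ → E`. -/
def rid : CTensor E ℂ →L[ℂ] E :=
  lift (LinearMap.lsmul ℂ E).flip
    (show Continuous fun z : E × ℂ => (LinearMap.lsmul ℂ E).flip z.1 z.2 from
      continuous_smul.comp continuous_swap)

@[simp]
theorem rid_tmul (c : ℂ) (x : E) : rid (tmul x c) = c • x := lift_tmul _ _ x c

end

/-- The linearized multiplication `A ⊗̂ A → A`, `a ⊗ b ↦ a b`. -/
def mul (A : Type*) [Ring A] [Algebra ℂ A] [UniformSpace A] [IsHatAlgebra A] :
    CTensor A A →L[ℂ] A := lift (LinearMap.mul ℂ A)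
    (show Continuous fun z : A × A => LinearMap.mul ℂ A z.1 z.2 from continuous_mul)

@[simp]
theorem mul_tmul {A : Type*} [Ring A] [Algebra ℂ A] [UniformSpace A] [IsHatAlgebra A] (a b : A) :
    mul A (tmul a b) = a * b := lift_tmul _ _ a b

end CTensor

/-! ### Hopf `⊗̂`-algebras, module algebras, smash products -/

/-- Hopf `⊗̂`-algebras: Hopf algebras in the symmetric monoidal category of complete locally convex
spaces with the complete projective tensor product. -/
class HopfHatAlgebra (H : Type*) [Ring H] [Algebra ℂ H] [UniformSpace H] [IsHatAlgebra H] where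
  comul : H →A[ℂ] CTensor H H
  counit : H →A[ℂ] ℂ
  antipode : H →L[ℂ] H
  coassoc : ∀ h, CTensor.assoc
    (CTensor.map comul.toContinuousLinearMap (ContinuousLinearMap.id ℂ H) (comul h)) =
    CTensor.map (ContinuousLinearMap.id ℂ H) comul.toContinuousLinearMap (comul h)
  counit_comul : ∀ h, CTensor.lid
    (CTensor.map counit.toContinuousLinearMap (ContinuousLinearMap.id ℂ H) (comul h)) = h
  comul_counit : ∀ h, CTensor.rid
    (CTensor.map (ContinuousLinearMap.id ℂ H) counit.toContinuousLinearMap (comul h)) = h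
  antipode_left : ∀ h, CTensor.mul H
    (CTensor.map antipode (ContinuousLinearMap.id ℂ H) (comul h)) = algebraMap ℂ H (counit h)
  antipode_right : ∀ h, CTensor.mul H
    (CTensor.map (ContinuousLinearMap.id ℂ H) antipode (comul h)) = algebraMap ℂ H (counit h)

open HopfHatAlgebra

section Hopf

variable {H K : Type*}
  [Ring H] [Algebra ℂ H] [UniformSpace H] [IsHatAlgebra H] [HopfHatAlgebra H]
  [Ring K] [Algebra ℂ K] [UniformSpace K] [IsHatAlgebra K] [HopfHatAlgebra K]

/-- Hopf `⊗̂`-algebra homomorphisms: continuous unital algebra homomorphisms compatible with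
comultiplication, counit and antipode. -/
structure IsHopfHom (β : H →A[ℂ] K) : Prop where
  comul : ∀ h, HopfHatAlgebra.comul (β h) =
    CTensor.map β.toContinuousLinearMap β.toContinuousLinearMap (HopfHatAlgebra.comul h)
  counit : ∀ h, HopfHatAlgebra.counit (β h) = HopfHatAlgebra.counit h
  antipode : ∀ h, HopfHatAlgebra.antipode (β h) = β (HopfHatAlgebra.antipode h)

/-- The continuous linear map `h ↦ h • x` on a `⊗̂`-algebra `H` given by an element `x` of a left
`H`-`⊗̂`-module. -/
def orbitMap (A : Type*) {X : Type*} [Ring A] [Algebra ℂ A] [TopologicalSpace A] [AddCommGroup X]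
    [Module ℂ X] [TopologicalSpace X] [Module A X] [IsScalarTower ℂ A X] [ContinuousSMul A X]
    (x : X) : A →L[ℂ] X where
  toFun h := h • x
  map_add' h k := add_smul h k x
  map_smul' c h := smul_assoc c h x
  cont := by fun_prop

@[simp]
theorem orbitMap_apply (A : Type*) {X : Type*} [Ring A] [Algebra ℂ A] [TopologicalSpace A]
    [AddCommGroup X] [Module ℂ X] [TopologicalSpace X] [Module A X] [IsScalarTower ℂ A X]
    [ContinuousSMul A X] (x : X) (h : A) : orbitMap A x h = h • x := rfl

/-- `H`-`⊗̂`-module algebras: a `⊗̂`-algebra `A` that is a left `H`-`⊗̂`-module such that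
`h • (a b) = ∑ (h₁ • a) (h₂ • b)` and `h • 1 = ε(h) 1`. -/
class IsHatModuleAlgebra (H A : Type*) [Ring H] [Algebra ℂ H] [UniformSpace H] [IsHatAlgebra H]
    [HopfHatAlgebra H] [Ring A] [Algebra ℂ A] [UniformSpace A] [IsHatAlgebra A] [Module H A] :
    Prop extends IsScalarTower ℂ H A, ContinuousSMul H A where
  smul_mul : ∀ (h : H) (a b : A),
    h • (a * b) = CTensor.mul A (CTensor.map (orbitMap H a) (orbitMap H b) (comul h))
  smul_one : ∀ h : H, h • (1 : A) = algebraMap ℂ A (counit h)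

variable {B : Type*} [Ring B] [Algebra ℂ B] [UniformSpace B] [IsHatAlgebra B]

/-- Right multiplication `x ↦ x b`. -/
def mulRightMap (b : B) : B →L[ℂ] B where
  toLinearMap := LinearMap.mulRight ℂ b
  cont := continuous_mul_const b

@[simp]
theorem mulRightMap_apply (b x : B) : mulRightMap b x = x * b := rfl

/-- The adjoint action of `H` on `B` along `ψ : H → B`: `h · b = ∑ ψ(h₁) b ψ(S(h₂))`. -/
def adjointAction (ψ : H →A[ℂ] B) (h : H) (b : B) : B :=
  CTensor.mul B (CTensor.map
    (mulRightMap b ∘L ψ.toContinuousLinearMap)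
    (ψ.toContinuousLinearMap ∘L antipode) (comul h))

end Hopf

/-- The analytic smash product `A #̂ H`: a `⊗̂`-algebra `P` with homomorphisms `i : A → P` and
`j : H → P`, where `i` intertwines the action of `H` on `A` with the adjoint action along `j`,
which is universal with this property. -/
structure IsSmashProduct (A H : Type u) {P : Type u}
    [Ring H] [Algebra ℂ H] [UniformSpace H] [IsHatAlgebra H] [HopfHatAlgebra H]
    [Ring A] [Algebra ℂ A] [UniformSpace A] [IsHatAlgebra A] [Module H A] [IsHatModuleAlgebra H A]
    [Ring P] [Algebra ℂ P] [UniformSpace P] [IsHatAlgebra P]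
    (i : A →A[ℂ] P) (j : H →A[ℂ] P) : Prop where
  equivariant : ∀ (h : H) (a : A), i (h • a) = adjointAction j h (i a)
  universal : ∀ (B : Type u) [Ring B] [Algebra ℂ B] [UniformSpace B] [IsHatAlgebra B]
    (φ : A →A[ℂ] B) (ψ : H →A[ℂ] B), (∀ (h : H) (a : A), φ (h • a) = adjointAction ψ h (φ a)) →
    ∃! θ : P →A[ℂ] B, θ.comp i = φ ∧ θ.comp j = ψ

/-! ### Derivations -/

/-- `X` is a `B`-`⊗̂`-bimodule: a complete Hausdorff locally convex space with commuting unital left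
and right actions of `B` that are jointly continuous. -/
class IsHatBimodule (B X : Type*) [Ring B] [Algebra ℂ B] [UniformSpace B]
    [AddCommGroup X] [Module ℂ X] [UniformSpace X] [Module B X] [Module Bᵐᵒᵖ X] : Prop extends
    IsCompleteLCS X where
  left_isScalarTower : IsScalarTower ℂ B X
  right_isScalarTower : IsScalarTower ℂ Bᵐᵒᵖ X
  smulCommClass : SMulCommClass B Bᵐᵒᵖ X
  left_continuousSMul : ContinuousSMul B X
  right_continuousSMul : ContinuousSMul Bᵐᵒᵖ X

section Der

variable {A B : Type*} [Ring A] [Algebra ℂ A] [UniformSpace A] [Ring B] [Algebra ℂ B]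
  [UniformSpace B]

/-- The continuous derivations `A → X`, where the `B`-`⊗̂`-bimodule `X` is regarded as an
`A`-`⊗̂`-bimodule through `φ : A → B`. -/
def Der (φ : A →A[ℂ] B) (X : Type*) [AddCommGroup X] [Module ℂ X] [UniformSpace X]
    [Module B X] [Module Bᵐᵒᵖ X] : Set (A →L[ℂ] X) :=
  {D | ∀ a a' : A, D (a * a') = φ a • D a' + MulOpposite.op (φ a') • D a}

/-- The map `Der(B, X) → Der(A, X)`, `D ↦ D ∘ φ`. -/
def derRestrict (φ : A →A[ℂ] B) (X : Type*) [AddCommGroup X] [Module ℂ X] [UniformSpace X]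
    [Module B X] [Module Bᵐᵒᵖ X] (D : Der (ContinuousAlgHom.id ℂ B) X) : Der φ X :=
  ⟨D.1 ∘L φ.toContinuousLinearMap, fun a a' => by simpa using D.2 (φ a) (φ a')⟩

end Der

/-- Property (UDE), the unique extension property for derivations. -/
def HasUDE {A B : Type u} [Ring A] [Algebra ℂ A] [UniformSpace A] [Ring B] [Algebra ℂ B]
    [UniformSpace B] (φ : A →A[ℂ] B) : Prop :=
  ∀ (X : Type u) [AddCommGroup X] [Module ℂ X] [UniformSpace X] [Module B X] [Module Bᵐᵒᵖ X]
    [IsHatBimodule B X], Function.Bijective (derRestrict φ X)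

end HatTensor

end

noncomputable section

namespace HatTensor

open HopfHatAlgebra

/-! ### The adjoint action -/

section Adjoint

variable {H K : Type*}
  [Ring H] [Algebra ℂ H] [UniformSpace H] [IsHatAlgebra H] [HopfHatAlgebra H]
  [Ring K] [Algebra ℂ K] [UniformSpace K] [IsHatAlgebra K] [HopfHatAlgebra K]
  {B C : Type*} [Ring B] [Algebra ℂ B] [UniformSpace B] [IsHatAlgebra B]
  [Ring C] [Algebra ℂ C] [UniformSpace C] [IsHatAlgebra C]

/-! A continuous derivation `Q → X` is the same thing as a `⊗̂`-algebra homomorphism from `Q` to the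
square-zero extension `Q ⊕ X` that lifts the identity. This turns extension of derivations into a
question about homomorphisms out of a smash product, which the universal property answers; no model
of the smash product on `R ⊗̂ H` is needed.

Given a derivation `D` on `P`, Property (UDE) of `α` and `β` extends its restrictions to `R` and `H`
to derivations on `S` and `K`, hence to homomorphisms from `S` and `K` to `Q ⊕ X`. They glue to a
homomorphism on `Q` once they are compatible with the adjoint action. On the images of `α` and `β`
this compatibility is inherited from `P`, and it spreads by density because the adjoint action is
jointly continuous (`continuous_adjointAction`, `equivariant_of_denseRange`). The glued homomorphism
is a section, and its second component extends `D`.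

Uniqueness of the extension follows from density of the range. That density holds because a smash
product has no proper closed subalgebra containing both factors
(`IsSmashProduct.eq_top_of_isClosed`). -/

/-- The adjoint action is natural in the target algebra. -/
theorem map_adjointAction (g : B →A[ℂ] C) (ψ : H →A[ℂ] B) (h : H) (b : B) :
    g (adjointAction ψ h b) = adjointAction (g.comp ψ) h (g b) := by
  -- This replaces the Sweedler computation: both sides are continuous linear maps evaluated at
  -- `comul h`, so elementary tensors suffice.
  have key : g.toContinuousLinearMap ∘L (CTensor.mul B ∘L CTensor.map
      (mulRightMap b ∘L ψ.toContinuousLinearMap) (ψ.toContinuousLinearMap ∘L antipode)) =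
      CTensor.mul C ∘L CTensor.map (mulRightMap (g b) ∘L (g.comp ψ).toContinuousLinearMap)
        ((g.comp ψ).toContinuousLinearMap ∘L antipode) :=
    CTensor.ext fun x y => by simp
  exact DFunLike.congr_fun key (comul h)

/-- The adjoint action along `ψ ∘ β` for a Hopf homomorphism `β`. -/
theorem adjointAction_comp {β : H →A[ℂ] K} (hβ : IsHopfHom β) (ψ : K →A[ℂ] B) (h : H)
    (b : B) : adjointAction (ψ.comp β) h b = adjointAction ψ (β h) b := by
  have key : CTensor.map (mulRightMap b ∘L (ψ.comp β).toContinuousLinearMap)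
      ((ψ.comp β).toContinuousLinearMap ∘L antipode) =
      CTensor.map (mulRightMap b ∘L ψ.toContinuousLinearMap)
        (ψ.toContinuousLinearMap ∘L antipode) ∘L
        CTensor.map β.toContinuousLinearMap β.toContinuousLinearMap :=
    CTensor.ext fun x y => by simp [hβ.antipode]
  rw [adjointAction, adjointAction, hβ.comul, key]
  rfl

/-- The adjoint action is jointly continuous. -/
theorem continuous_adjointAction (ψ : H →A[ℂ] B) :
    Continuous fun z : H × B => adjointAction ψ z.1 z.2 := by
  -- The flip lets `b` become a tensor factor: `x ⊗ y, b ↦ x ⊗ (y ⊗ b) ↦ x ⊗ b y ↦ x b y`. Joint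
  -- continuity then comes entirely from `CTensor.continuous_assocBilin`.
  let m : CTensor B B →L[ℂ] B := CTensor.lift (LinearMap.mul ℂ B).flip
    (show Continuous fun z : B × B => (LinearMap.mul ℂ B).flip z.1 z.2 from
      continuous_snd.mul continuous_fst)
  have key : ∀ (h : H) (b : B), adjointAction ψ h b =
      CTensor.mul B (CTensor.map (ContinuousLinearMap.id ℂ B) m (CTensor.assocBilin
        (CTensor.map ψ.toContinuousLinearMap (ψ.toContinuousLinearMap ∘L antipode) (comul h))
        b)) := by
    intro h b
    -- For fixed `b`, `assocBilin` is by definition the map `id ⊗̂ (· ⊗ b)`.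
    have h1 : CTensor.mul B ∘L CTensor.map (mulRightMap b ∘L ψ.toContinuousLinearMap)
        (ψ.toContinuousLinearMap ∘L antipode) =
        CTensor.mul B ∘L CTensor.map (ContinuousLinearMap.id ℂ B) m ∘L
          CTensor.map (ContinuousLinearMap.id ℂ B) (CTensor.tmulRight b) ∘L
          CTensor.map ψ.toContinuousLinearMap (ψ.toContinuousLinearMap ∘L antipode) :=
      CTensor.ext fun x y => by simp [m, CTensor.tmulRight_apply, mul_assoc]
    exact DFunLike.congr_fun h1 (comul h)
  have h2 : Continuous fun h : H =>
      CTensor.map ψ.toContinuousLinearMap (ψ.toContinuousLinearMap ∘L antipode) (comul h) :=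
    (ContinuousLinearMap.continuous _).comp comul.cont
  have h3 := CTensor.continuous_assocBilin.comp (h2.prodMap (continuous_id (X := B)))
  exact ((CTensor.mul B ∘L CTensor.map (ContinuousLinearMap.id ℂ B) m).continuous.comp
    h3).congr fun z => (key z.1 z.2).symm

/-- Equivariance for the adjoint action can be checked on dense subsets. -/
theorem equivariant_of_denseRange {A Y Z : Type*} [Ring A] [Algebra ℂ A] [UniformSpace A]
    [IsHatAlgebra A] [Module H A] [IsHatModuleAlgebra H A] {β : Y → H} {α : Z → A}
    (hβ : DenseRange β) (hα : DenseRange α) (φ : A →A[ℂ] B) (ψ : H →A[ℂ] B)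
    (h : ∀ y z, φ (β y • α z) = adjointAction ψ (β y) (φ (α z))) (k : H) (a : A) :
    φ (k • a) = adjointAction ψ k (φ a) := by
  have hc : Continuous φ := φ.cont
  have h1 : Continuous fun z : H × A => φ (z.1 • z.2) := hc.comp continuous_smul
  have h2 : Continuous fun z : H × A => adjointAction ψ z.1 (φ z.2) :=
    Continuous.comp (g := fun z : H × B => adjointAction ψ z.1 z.2)
      (f := fun z : H × A => (z.1, φ z.2)) (continuous_adjointAction ψ)
      (continuous_fst.prodMk (hc.comp continuous_snd))
  exact congrFun ((hβ.prodMap hα).equalizer h1 h2 (funext fun y => h y.1 y.2)) (k, a)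

end Adjoint

/-! ### Closed subalgebras and generation of the smash product -/

/-- Closedness supplies completeness; everything else is inherited from `B`. This makes closed
subalgebras admissible targets for the universal property. -/
theorem isHatAlgebra_of_isClosed {B : Type*} [Ring B] [Algebra ℂ B] [UniformSpace B]
    [IsHatAlgebra B] (C : Subalgebra ℂ B) (hC : IsClosed (C : Set B)) : IsHatAlgebra C :=
  have : CompleteSpace C := hC.completeSpace_coe
  have : IsUniformAddGroup C := C.toSubring.toAddSubgroup.isUniformAddGroup
  have : PolynormableSpace ℂ C :=
    inferInstanceAs (PolynormableSpace ℂ (Subalgebra.toSubmodule C))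
  { }

section Smash

variable {A H P : Type u}
  [Ring H] [Algebra ℂ H] [UniformSpace H] [IsHatAlgebra H] [HopfHatAlgebra H]
  [Ring A] [Algebra ℂ A] [UniformSpace A] [IsHatAlgebra A] [Module H A] [IsHatModuleAlgebra H A]
  [Ring P] [Algebra ℂ P] [UniformSpace P] [IsHatAlgebra P]
  {i : A →A[ℂ] P} {j : H →A[ℂ] P}

/-- Homomorphisms out of a smash product are determined by their restrictions. -/
theorem IsSmashProduct.hom_ext (hP : IsSmashProduct A H i j) {B : Type u} [Ring B] [Algebra ℂ B]
    [UniformSpace B] [IsHatAlgebra B] {f g : P →A[ℂ] B} (hi : f.comp i = g.comp i)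
    (hj : f.comp j = g.comp j) : f = g := by
  -- Both maps solve the universal problem posed by the restrictions of `g`; that this problem is
  -- equivariant is the naturality of the adjoint action.
  refine (hP.universal B (g.comp i) (g.comp j) fun h a => ?_).unique ⟨hi, hj⟩ ⟨rfl, rfl⟩
  rw [ContinuousAlgHom.comp_apply, hP.equivariant, map_adjointAction, ContinuousAlgHom.comp_apply]

/-- A closed subalgebra of a smash product that contains both factors is everything. -/
theorem IsSmashProduct.eq_top_of_isClosed (hP : IsSmashProduct A H i j) (C : Subalgebra ℂ P)
    (hC : IsClosed (C : Set P)) (hi : ∀ a, i a ∈ C) (hj : ∀ h, j h ∈ C) : C = ⊤ := by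
  have := isHatAlgebra_of_isClosed C hC
  -- The corestrictions induce `θ : P → C`. Followed by the inclusion it fixes both factors, so it
  -- is the identity and every element lies in `C`. Equivariance in `C` may be checked after the
  -- injective inclusion.
  obtain ⟨θ, ⟨h1, h2⟩, -⟩ := hP.universal C (i.codRestrict C hi) (j.codRestrict C hj)
    fun h a => Subtype.ext <| by
      have := map_adjointAction C.valA (j.codRestrict C hj) h (i.codRestrict C hi a)
      exact (hP.equivariant h a).trans this.symm
  have key : C.valA.comp θ = ContinuousAlgHom.id ℂ P := hP.hom_ext
    (ContinuousAlgHom.ext fun a => congrArg Subtype.val (DFunLike.congr_fun h1 a))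
    (ContinuousAlgHom.ext fun h => congrArg Subtype.val (DFunLike.congr_fun h2 h))
  refine (Algebra.eq_top_iff).2 fun p => ?_
  have h3 : (θ p : P) = p := DFunLike.congr_fun key p
  exact h3 ▸ (θ p).2

end Smash

/-! ### Derivations and square-zero extensions -/

section SqZero

variable {B X : Type*} [Ring B] [Algebra ℂ B] [UniformSpace B]
  [AddCommGroup X] [Module ℂ X] [UniformSpace X] [Module B X] [Module Bᵐᵒᵖ X] [IsHatBimodule B X]

attribute [local instance] IsHatBimodule.left_isScalarTower IsHatBimodule.right_isScalarTower
  IsHatBimodule.smulCommClass IsHatBimodule.left_continuousSMul IsHatBimodule.right_continuousSMul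

/-- The square-zero extension of a `⊗̂`-algebra by a `⊗̂`-bimodule is a `⊗̂`-algebra. -/
theorem isHatAlgebra_trivSqZeroExt [IsHatAlgebra B] :
    IsHatAlgebra (TrivSqZeroExt B X) :=
  have : PolynormableSpace ℂ (TrivSqZeroExt B X) :=
    inferInstanceAs (PolynormableSpace ℂ (B × X))
  { }

variable {A : Type*} [Ring A] [Algebra ℂ A] [UniformSpace A]

/-- The homomorphism `a ↦ (φ a, D a)` into the square-zero extension given by a derivation. -/
def derHom (φ : A →A[ℂ] B) (D : Der φ X) : A →A[ℂ] TrivSqZeroExt B X where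
  toFun a := (φ a, D.1 a)
  map_one' := by
    -- The Leibniz rule at `1 * 1` reads `D 1 = D 1 + D 1`, so `D 1 = 0`.
    have h := D.2 1 1
    simp only [mul_one, map_one, one_smul, MulOpposite.op_one, left_eq_add] at h
    exact Prod.ext (map_one φ) h
  map_mul' a a' := Prod.ext (map_mul φ a a') (D.2 a a')
  map_zero' := Prod.ext (map_zero φ) (map_zero D.1)
  map_add' a a' := Prod.ext (map_add φ a a') (map_add D.1 a a')
  commutes' c := by
    have h := D.2 1 1
    simp only [mul_one, map_one, one_smul, MulOpposite.op_one, left_eq_add] at h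
    refine Prod.ext (AlgHomClass.commutes φ c) ?_
    change D.1 (algebraMap ℂ A c) = 0
    rw [Algebra.algebraMap_eq_smul_one, map_smul, h, smul_zero]
  cont := φ.cont.prodMk D.1.cont

/-- The projection of the square-zero extension. -/
def sqZeroFst : TrivSqZeroExt B X →A[ℂ] B where
  toAlgHom := TrivSqZeroExt.fstHom ℂ B X
  cont := TrivSqZeroExt.continuous_fst

/-- The derivation given by a section of the square-zero extension. -/
def derOfSection (θ : B →A[ℂ] TrivSqZeroExt B X) (hθ : ∀ b, (θ b).fst = b) :
    Der (ContinuousAlgHom.id ℂ B) X :=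
  ⟨{ toFun := fun b => (θ b).snd
     map_add' := fun b b' => by rw [map_add, TrivSqZeroExt.snd_add]
     map_smul' := fun c b => by rw [map_smul, TrivSqZeroExt.snd_smul, RingHom.id_apply]
     cont := TrivSqZeroExt.continuous_snd.comp θ.cont }, fun b b' => by
    change (θ (b * b')).snd = b • (θ b').snd + MulOpposite.op b' • (θ b).snd
    rw [map_mul, TrivSqZeroExt.snd_mul, hθ, hθ]⟩

variable {A Q X : Type u} [Ring A] [Algebra ℂ A] [UniformSpace A]
  {B : Type u} [Ring B] [Algebra ℂ B] [UniformSpace B] [IsHatAlgebra B]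
  [Ring Q] [Algebra ℂ Q] [UniformSpace Q] [IsHatAlgebra Q]
  [AddCommGroup X] [Module ℂ X] [UniformSpace X] [Module Q X] [Module Qᵐᵒᵖ X] [IsHatBimodule Q X]

/-- Property (UDE) extends derivations with values in bimodules obtained by restriction of
scalars. -/
theorem HasUDE.exists_extension {φ : A →A[ℂ] B} (hφ : HasUDE φ) (g : B →A[ℂ] Q)
    (D : Der (g.comp φ) X) : ∃ D' : Der g X, ∀ a, D'.1 (φ a) = D.1 a := by
  -- Restricting scalars along `g` makes `X` a `B`-`⊗̂`-bimodule. With these actions the Leibniz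
  -- rules over `φ` and over `g.comp φ` agree definitionally.
  let _ : Module B X := Module.compHom X (g : B →+* Q)
  let _ : Module Bᵐᵒᵖ X := Module.compHom X (RingHom.op (g : B →+* Q))
  have hl : ∀ (b : B) (x : X), b • x = g b • x := fun _ _ => rfl
  have hr : ∀ (b : Bᵐᵒᵖ) (x : X), b • x = MulOpposite.op (g b.unop) • x := fun _ _ => rfl
  have : IsHatBimodule B X :=
    { left_isScalarTower := ⟨fun c b x => by rw [hl, hl, map_smul, smul_assoc]⟩
      right_isScalarTower := ⟨fun c b x => by
        rw [hr, hr, MulOpposite.unop_smul, map_smul, MulOpposite.op_smul, smul_assoc]⟩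
      smulCommClass := ⟨fun b b' x => by rw [hl, hr, hr, hl, smul_comm]⟩
      left_continuousSMul := ⟨(g.cont.comp continuous_fst).smul continuous_snd⟩
      right_continuousSMul := ⟨(MulOpposite.continuous_op.comp (g.cont.comp
        (MulOpposite.continuous_unop.comp continuous_fst))).smul continuous_snd⟩ }
  obtain ⟨D', hD'⟩ := (hφ X).2 ⟨D.1, D.2⟩
  exact ⟨⟨D'.1, D'.2⟩, fun a => DFunLike.congr_fun (congrArg Subtype.val hD') a⟩

end SqZero

/-! ### Induced maps of smash products: existence, density, Property (UDE) -/

section Functoriality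

variable {H K R S P Q : Type u}
    [Ring H] [Algebra ℂ H] [UniformSpace H] [IsHatAlgebra H] [HopfHatAlgebra H]
    [Ring K] [Algebra ℂ K] [UniformSpace K] [IsHatAlgebra K] [HopfHatAlgebra K]
    [Ring R] [Algebra ℂ R] [UniformSpace R] [IsHatAlgebra R] [Module H R] [IsHatModuleAlgebra H R]
    [Ring S] [Algebra ℂ S] [UniformSpace S] [IsHatAlgebra S] [Module K S] [IsHatModuleAlgebra K S]
    [Ring P] [Algebra ℂ P] [UniformSpace P] [IsHatAlgebra P]
    [Ring Q] [Algebra ℂ Q] [UniformSpace Q] [IsHatAlgebra Q]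
    {β : H →A[ℂ] K} {α : R →A[ℂ] S} {i : R →A[ℂ] P} {j : H →A[ℂ] P}
    {i' : S →A[ℂ] Q} {j' : K →A[ℂ] Q}

/-- Functoriality of the analytic smash product. -/
theorem IsSmashProduct.exists_map (hβ : IsHopfHom β) (hα : ∀ (h : H) (r : R), α (h • r) = β h • α r)
    (hP : IsSmashProduct R H i j) (hQ : IsSmashProduct S K i' j') :
    ∃ f : P →A[ℂ] Q, f.comp i = i'.comp α ∧ f.comp j = j'.comp β :=
  (hP.universal Q (i'.comp α) (j'.comp β) fun h r => by
    rw [ContinuousAlgHom.comp_apply, hα, hQ.equivariant, adjointAction_comp hβ,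
      ContinuousAlgHom.comp_apply]).exists

/-- Put `h = 1` and `r = 1`. This passes from the formula on products to the two restrictions, the
form in which the universal property applies. -/
theorem comp_eq_of_apply_mul {f : P →A[ℂ] Q}
    (hf : ∀ (r : R) (h : H), f (i r * j h) = i' (α r) * j' (β h)) :
    f.comp i = i'.comp α ∧ f.comp j = j'.comp β :=
  ⟨ContinuousAlgHom.ext fun r => by simpa using hf r 1,
    ContinuousAlgHom.ext fun h => by simpa using hf 1 h⟩

/-- The closure of the range is a closed subalgebra. It contains `i' (α r)` and `j' (β h)`, hence by
density of `α` and `β` both factors of `Q`, which generate. -/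
theorem IsSmashProduct.denseRange_map (hQ : IsSmashProduct S K i' j') {f : P →A[ℂ] Q}
    (hi : f.comp i = i'.comp α) (hj : f.comp j = j'.comp β) (hα : DenseRange α)
    (hβ : DenseRange β) : DenseRange f := by
  let C : Subalgebra ℂ Q := (f : P →ₐ[ℂ] Q).range.topologicalClosure
  have hC : IsClosed (C : Set Q) := Subalgebra.isClosed_topologicalClosure _
  have hCf : ∀ p, f p ∈ C := fun p => subset_closure ⟨p, rfl⟩
  have hC' : C = ⊤ := hQ.eq_top_of_isClosed C hC
    (fun s => hα.induction_on s (hC.preimage i'.cont) fun r =>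
      (DFunLike.congr_fun hi r : f (i r) = i' (α r)) ▸ hCf _)
    (fun k => hβ.induction_on k (hC.preimage j'.cont) fun h =>
      (DFunLike.congr_fun hj h : f (j h) = j' (β h)) ▸ hCf _)
  intro q
  have : q ∈ C := hC' ▸ Algebra.mem_top
  exact this

attribute [local instance] IsHatBimodule.left_isScalarTower IsHatBimodule.right_isScalarTower
  IsHatBimodule.smulCommClass IsHatBimodule.left_continuousSMul IsHatBimodule.right_continuousSMul
  isHatAlgebra_trivSqZeroExt

/-- Derivations are handled as homomorphisms into `TrivSqZeroExt Q X`: those on `S` and `K` are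
glued there by the universal property of `Q`. -/
theorem IsSmashProduct.hasUDE_map (hβ : IsHopfHom β)
    (hα : ∀ (h : H) (r : R), α (h • r) = β h • α r)
    (hP : IsSmashProduct R H i j) (hQ : IsSmashProduct S K i' j') {f : P →A[ℂ] Q}
    (hi : f.comp i = i'.comp α) (hj : f.comp j = j'.comp β) (hαd : DenseRange α)
    (hαU : HasUDE α) (hβd : DenseRange β) (hβU : HasUDE β) : HasUDE f := by
  intro X _ _ _ _ _ _
  refine ⟨fun D₁ D₂ h => Subtype.ext (DFunLike.coe_injective ?_), fun D => ?_⟩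
  -- Two continuous maps into a Hausdorff space that agree on the dense range of `f` coincide.
  · exact (hQ.denseRange_map hi hj hαd hβd).equalizer D₁.1.continuous D₂.1.continuous
      (congrArg (fun E : Der f X => ⇑E.1) h)
  have hi' : ∀ r, f (i r) = i' (α r) := DFunLike.congr_fun hi
  have hj' : ∀ h, f (j h) = j' (β h) := DFunLike.congr_fun hj
  -- Since `f ∘ i = i' ∘ α`, the restriction of `D` to `R` is a derivation for the action of `R` on
  -- `X` through `i' ∘ α`, so it extends along `α`; likewise for `H` and `β`.
  obtain ⟨DS, hDS⟩ := hαU.exists_extension i' (X := X) ⟨D.1 ∘L i.toContinuousLinearMap,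
    fun a a' => by simpa [hi'] using D.2 (i a) (i a')⟩
  obtain ⟨DK, hDK⟩ := hβU.exists_extension j' (X := X) ⟨D.1 ∘L j.toContinuousLinearMap,
    fun a a' => by simpa [hj'] using D.2 (j a) (j a')⟩
  have hρi : (derHom f D).comp i = (derHom i' DS).comp α :=
    ContinuousAlgHom.ext fun r => TrivSqZeroExt.ext (hi' r) (hDS r).symm
  have hρj : (derHom f D).comp j = (derHom j' DK).comp β :=
    ContinuousAlgHom.ext fun h => TrivSqZeroExt.ext (hj' h) (hDK h).symm
  -- `DS` and `DK` were chosen independently; their compatibility is known only over the images of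
  -- `α` and `β`, where both homomorphisms come from `derHom f D` and equivariance in `P` applies.
  have equi := equivariant_of_denseRange hβd hαd (derHom i' DS) (derHom j' DK) fun h r => by
    have h1 : ∀ r, derHom f D (i r) = derHom i' DS (α r) := DFunLike.congr_fun hρi
    rw [← hα, ← h1, hP.equivariant, map_adjointAction, hρj, adjointAction_comp hβ, h1]
  obtain ⟨θ, ⟨hθi, hθj⟩, -⟩ := hQ.universal (TrivSqZeroExt Q X) (derHom i' DS) (derHom j' DK) equi
  -- The first component of `θ` restricts to `i'` and `j'`, so `θ` is a section and its second
  -- component a derivation on `Q`.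
  have hθ : (sqZeroFst (X := X)).comp θ = ContinuousAlgHom.id ℂ Q := hQ.hom_ext
    (ContinuousAlgHom.ext fun s => congrArg TrivSqZeroExt.fst (DFunLike.congr_fun hθi s))
    (ContinuousAlgHom.ext fun k => congrArg TrivSqZeroExt.fst (DFunLike.congr_fun hθj k))
  -- Agreement on both factors of `P` suffices; second components then say that the new derivation
  -- restricts to `D`.
  have hθf : θ.comp f = derHom f D := hP.hom_ext
    (by rw [hρi, ← hθi]; exact congrArg θ.comp hi)
    (by rw [hρj, ← hθj]; exact congrArg θ.comp hj)
  exact ⟨derOfSection θ (DFunLike.congr_fun hθ), Subtype.ext (ContinuousLinearMap.ext fun p =>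
    congrArg TrivSqZeroExt.snd (DFunLike.congr_fun hθf p))⟩

end Functoriality

end HatTensor

end

open HatTensor in
theorem mainTheorem5 {H K R S P Q : Type u}
    [Ring H] [Algebra ℂ H] [UniformSpace H] [IsHatAlgebra H] [HopfHatAlgebra H]
    [Ring K] [Algebra ℂ K] [UniformSpace K] [IsHatAlgebra K] [HopfHatAlgebra K]
    [Ring R] [Algebra ℂ R] [UniformSpace R] [IsHatAlgebra R] [Module H R] [IsHatModuleAlgebra H R]
    [Ring S] [Algebra ℂ S] [UniformSpace S] [IsHatAlgebra S] [Module K S] [IsHatModuleAlgebra K S]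
    [Ring P] [Algebra ℂ P] [UniformSpace P] [IsHatAlgebra P]
    [Ring Q] [Algebra ℂ Q] [UniformSpace Q] [IsHatAlgebra Q]
    (β : H →A[ℂ] K) (hβ : IsHopfHom β)
    (α : R →A[ℂ] S) (hα : ∀ (h : H) (r : R), α (h • r) = β h • α r)
    (i : R →A[ℂ] P) (j : H →A[ℂ] P) (hP : IsSmashProduct R H i j)
    (i' : S →A[ℂ] Q) (j' : K →A[ℂ] Q) (hQ : IsSmashProduct S K i' j')
    (hαd : DenseRange α) (hαU : HasUDE α) (hβd : DenseRange β) (hβU : HasUDE β) :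
    (∃! f : P →A[ℂ] Q, ∀ (r : R) (h : H), f (i r * j h) = i' (α r) * j' (β h)) ∧
      ∀ f : P →A[ℂ] Q, (∀ (r : R) (h : H), f (i r * j h) = i' (α r) * j' (β h)) →
        DenseRange f ∧ HasUDE f := by
  obtain ⟨f, hi, hj⟩ := hP.exists_map hβ hα hQ
  refine ⟨⟨f, fun r h => ?_, fun g hg => ?_⟩, fun g hg => ?_⟩
  · rw [map_mul]
    exact congrArg₂ _ (DFunLike.congr_fun hi r) (DFunLike.congr_fun hj h)
  · obtain ⟨gi, gj⟩ := comp_eq_of_apply_mul hg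
    exact hP.hom_ext (gi.trans hi.symm) (gj.trans hj.symm)
  · obtain ⟨gi, gj⟩ := comp_eq_of_apply_mul hg
    exact ⟨hQ.denseRange_map gi gj hαd hβd,
      hP.hasUDE_map hβ hα hQ gi gj hαd hαU hβd hβU⟩
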